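/- Let $I$ be a nonempty totally ordered set (so that $\theta\ge 2$ is the order type of the chain $\{0\}+I$), and let $\langle A,\vee,\wedge,0,1,\{\phi_i\}_{i\in I},\{\overline\phi_i\}_{i\in I}\rangle$ be a $\theta$-valued Łukasiewicz–Moisil algebra (LM$_\theta$-algebra): $\langle A,\vee,\wedge,0,1\rangle$ is a bounded distributive lattice, each $\phi_i$ is an endomorphism of this bounded lattice, $\phi_i x\vee\overline\phi_i x=1$ and $\phi_i x\wedge\overline\phi_i x=0$, $\phi_i\phi_j x=\phi_j x$, $i\le j$ implies $\phi_i x\le\phi_j x$, and if $\phi_i x=\phi_i y$ for all $i\in I$ then $x=y$. Let $X(A)$ be the set of all prime filters of $A$, put $\sigma_A(a)=\{P\in X(A): a\in P\}$ for $a\in A$, give $X(A)$ the topology with subbasis the sets $\sigma_A(a)$ and $X(A)\setminus\sigma_A(a)$, $a\in A$, and let $f_i^A:X(A)\to X(A)$, $f_i^A(P)=\phi_i^{-1}(P)$, for $i\in I$. A congruence on $A$ is an equivalence relation compatible with $\vee$, $\wedge$ and all $\phi_i$, $\overline\phi_i$; it is called Boolean if it has a complement in the lattice of all congruences on $A$.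 Let $\Theta(a,b)$ denote the least congruence on $A$ containing $(a,b)$. Then for all $a,b\in A$ with $a\le b$ the following conditions are equivalent: (i) $\Theta(a,b)$ is a Boolean congruence on $A$; (ii) $\bigcup_{i\in I}(f_i^A)^{-1}(\sigma_A(b)\setminus\sigma_A(a))$ is a closed subset of $X(A)$; (iii) $\bigcup_{i\in I}\sigma_A(\phi_i b\wedge\overline\phi_i a)$ is a closed subset of $X(A)$. -/

import Mathlib

namespace LM

universe u v

/-- A `θ`-valued Łukasiewicz–Moisil algebra (without negation) on the bounded distributive lattice
`A`. The index set `I` is the chain for which `θ` is the order type of `{0} + I`. -/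
class LMAlgebra (I : Type u) (A : Type v) [LinearOrder I] [DistribLattice A] [BoundedOrder A] where
  /-- The operations `φ i`, which are endomorphisms of bounded distributive lattices. -/
  φ : I → BoundedLatticeHom A A
  /-- The operations `φbar i`; `φbar i x` is the complement of `φ i x`. -/
  φbar : I → A → A
  φ_sup_φbar : ∀ (i : I) (x : A), φ i x ⊔ φbar i x = ⊤
  φ_inf_φbar : ∀ (i : I) (x : A), φ i x ⊓ φbar i x = ⊥
  φ_φ : ∀ (i j : I) (x : A), φ i (φ j x) = φ j x
  φ_mono : ∀ i j : I, i ≤ j → ∀ x : A, φ i x ≤ φ j x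
  determination : ∀ x y : A, (∀ i : I, φ i x = φ i y) → x = y

/-- The operations `φ i` of an LM-algebra. -/
def phi {I : Type u} {A : Type v} [LinearOrder I] [DistribLattice A] [BoundedOrder A]
    [LMAlgebra I A] (i : I) : BoundedLatticeHom A A :=
  LMAlgebra.φ i

/-- The operations `φbar i` of an LM-algebra. -/
def phibar {I : Type u} {A : Type v} [LinearOrder I] [DistribLattice A] [BoundedOrder A]
    [LMAlgebra I A] (i : I) : A → A :=
  LMAlgebra.φbar i

section Congruences

/-- A congruence of the LM-algebra `A`: an equivalence relation on `A` that is compatible with all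
the operations. -/
structure LMCon (I : Type u) (A : Type v) [LinearOrder I] [DistribLattice A] [BoundedOrder A]
    [LMAlgebra I A] extends LatticeCon A where
  map_phi : ∀ (i : I) {x y : A}, r x y → r (phi i x) (phi i y)
  map_phibar : ∀ (i : I) {x y : A}, r x y → r (phibar i x) (phibar i y)

variable {I : Type u} {A : Type v} [LinearOrder I] [DistribLattice A] [BoundedOrder A]
  [LMAlgebra I A]

theorem LMCon.ext_r {c d : LMCon I A} (h : ∀ x y : A, c.r x y ↔ d.r x y) : c = d := by
  obtain ⟨⟨⟨r, _⟩, _, _⟩, _, _⟩ := c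
  obtain ⟨⟨⟨s, _⟩, _, _⟩, _, _⟩ := d
  have : r = s := funext fun x => funext fun y => propext (h x y)
  subst this
  rfl

/-- Congruences are ordered by inclusion. -/
instance : PartialOrder (LMCon I A) where
  le c d := ∀ x y : A, c.r x y → d.r x y
  le_refl _ _ _ h := h
  le_trans _ _ _ h₁ h₂ x y h := h₂ x y (h₁ x y h)
  le_antisymm _ _ h₁ h₂ := LMCon.ext_r fun x y => ⟨h₁ x y, h₂ x y⟩

/-- The intersection of a set of congruences. -/
instance : InfSet (LMCon I A) where
  sInf S :=
    { r := fun x y => ∀ c ∈ S, c.r x y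
      iseqv :=
        { refl := fun x c _ => c.iseqv.refl x
          symm := fun h c hc => c.iseqv.symm (h c hc)
          trans := fun h₁ h₂ c hc => c.iseqv.trans (h₁ c hc) (h₂ c hc) }
      inf := fun h₁ h₂ c hc => c.inf (h₁ c hc) (h₂ c hc)
      sup := fun h₁ h₂ c hc => c.sup (h₁ c hc) (h₂ c hc)
      map_phi := fun i _ _ h c hc => c.map_phi i (h c hc)
      map_phibar := fun i _ _ h c hc => c.map_phibar i (h c hc) }

/-- The complete lattice of all congruences of the LM-algebra `A`, ordered by inclusion. -/
instance : CompleteLattice (LMCon I A) :=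
  completeLatticeOfInf (LMCon I A) fun _ =>
    ⟨fun _ hc _ _ h => h _ hc, fun _ hd x y h c hc => hd hc x y h⟩

variable (I) in
/-- The principal congruence `Θ(a, b)`: the least congruence that contains the pair `(a, b)`. -/
def principalCon (a b : A) : LMCon I A :=
  sInf {c | c.r a b}

/-- A congruence is Boolean if it is a Boolean (that is, complemented) element of the lattice of
all congruences. -/
def IsBooleanCon (c : LMCon I A) : Prop :=
  IsComplemented c

end Congruences

section Spectrum

/-- The set `X(A)` of all prime filters of `A`. -/
def PrimeFilter (A : Type v) [DistribLattice A] [BoundedOrder A] : Type v :=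
  {P : Order.PFilter A // P.IsPrime}

/-- `σ(a)` is the set of the prime filters that contain `a`. -/
def sigma {A : Type v} [DistribLattice A] [BoundedOrder A] (a : A) : Set (PrimeFilter A) :=
  {P | a ∈ P.1}

/-- Prime filters are ordered by inclusion. -/
instance (A : Type v) [DistribLattice A] [BoundedOrder A] : PartialOrder (PrimeFilter A) :=
  inferInstanceAs (PartialOrder {P : Order.PFilter A // P.IsPrime})

/-- The topology on `X(A)` with subbasis the sets `σ(a)` and `X(A) \ σ(a)`. -/
instance (A : Type v) [DistribLattice A] [BoundedOrder A] : TopologicalSpace (PrimeFilter A) :=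
  TopologicalSpace.generateFrom {U | ∃ a : A, U = sigma a ∨ U = (sigma a)ᶜ}

variable {A : Type v} [DistribLattice A] [BoundedOrder A]

theorem isPFilter_preimage (g : BoundedLatticeHom A A) (P : Order.PFilter A) :
    Order.IsPFilter (g ⁻¹' (P : Set A)) := by
  refine Order.IsPFilter.of_def ⟨⊤, ?_⟩ ?_ ?_
  · change g ⊤ ∈ P
    rw [map_top]
    exact Order.PFilter.top_mem
  · intro x hx y hy
    refine ⟨x ⊓ y, ?_, inf_le_left, inf_le_right⟩
    change g (x ⊓ y) ∈ P
    rw [map_inf]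
    exact Order.PFilter.inf_mem hx hy
  · intro x y hxy hx
    exact Order.PFilter.mem_of_le (OrderHomClass.mono g hxy) hx

theorem isPrime_preimage (g : BoundedLatticeHom A A) (P : Order.PFilter A) (hP : P.IsPrime) :
    (isPFilter_preimage g P).toPFilter.IsPrime := by
  refine ⟨⟨?_, ⟨⊥, ?_⟩, ?_⟩⟩
  · intro x y hyx hx hy
    exact hx (Order.PFilter.mem_of_le (F := P) (OrderHomClass.mono g hyx) hy)
  · intro h
    have h' : g ⊥ ∈ P := h
    rw [map_bot] at h'
    exact hP.compl_ideal.toIdeal.bot_mem h'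
  · intro x hx y hy
    refine ⟨x ⊔ y, ?_, le_sup_left, le_sup_right⟩
    intro h
    have h' : g (x ⊔ y) ∈ P := h
    rw [map_sup] at h'
    exact Order.Ideal.sup_mem (s := hP.compl_ideal.toIdeal) hx hy h'

/-- The maps `f i : X(A) → X(A)`, `f i P = (φ i)⁻¹(P)`, of the space associated with `A`. -/
def spaceMap {I : Type u} [LinearOrder I] [LMAlgebra I A] (i : I) (P : PrimeFilter A) :
    PrimeFilter A :=
  ⟨(isPFilter_preimage (phi i) P.1).toPFilter, isPrime_preimage (phi i) P.1 P.2⟩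

end Spectrum

end LM

namespace LM

universe u v

/-! ### Congruences and ideals. -/

section Congruences

variable {I : Type u} {A : Type v} [LinearOrder I] [DistribLattice A] [BoundedOrder A]
  [LMAlgebra I A]

/-! Put `u i = phi i b ⊓ phibar i a`. Since `sigma (u i)` is the preimage of `sigma b \ sigma a`
under `spaceMap i`, (ii) and (iii) concern the same open set `W`. If `W` is closed, compactness of
the spectrum makes `W = sigma e` with `e` a finite join of the `u i`. This `e` is complemented and
fixed by every `phi i`, and `Θ(a, b)` has as complement the congruence `idealCon` of the ideal below
the complement of `e` (`isBooleanCon_principalCon_of_isComplemented`). Conversely, a complement of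
`Θ(a, b)` splits `⊤` into complementary elements `s`, `t` of the two kernels
(`LMCon.exists_isCompl_of_isCompl`), and then `W = sigma s`, which is clopen. -/

theorem phi_phi (i j : I) (x : A) : phi i (phi j x) = phi j x :=
  LMAlgebra.φ_φ i j x

theorem isCompl_phi_phibar (i : I) (x : A) : IsCompl (phi i x) (phibar i x) :=
  IsCompl.of_eq (LMAlgebra.φ_inf_φbar i x) (LMAlgebra.φ_sup_φbar i x)

theorem phi_eq_of_isCompl {i : I} {x y : A} (h : IsCompl x y) (hx : phi i x = x) :
    phi i y = y := by
  have h' : IsCompl x (phi i y) := by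
    have := h.map (phi i)
    rwa [hx] at this
  exact h'.right_unique h

theorem phi_phibar (i j : I) (x : A) : phi i (phibar j x) = phibar j x :=
  phi_eq_of_isCompl (isCompl_phi_phibar j x) (phi_phi i j x)

/-- Complementation still reverses order modulo `j`; this makes `idealCon` compatible with `phibar`.
-/
theorem le_sup_of_isCompl {x x' y y' j : A} (hx : IsCompl x x') (hy : IsCompl y y')
    (h : y ≤ x ⊔ j) : x' ≤ y' ⊔ j := by
  have hle : x' ⊓ y ≤ j := by
    calc x' ⊓ y ≤ x' ⊓ (x ⊔ j) := inf_le_inf_left _ h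
      _ = x' ⊓ j := by rw [inf_sup_left, hx.symm.inf_eq_bot, bot_sup_eq]
      _ ≤ j := inf_le_right
  calc x' = x' ⊓ y ⊔ x' ⊓ y' := by rw [← inf_sup_left, hy.sup_eq_top, inf_top_eq]
    _ ≤ y' ⊔ j := sup_le (hle.trans le_sup_right) (inf_le_right.trans le_sup_left)

theorem sup_eq_sup_of_isCompl {x x' y y' j : A} (hx : IsCompl x x') (hy : IsCompl y y')
    (h : x ⊔ j = y ⊔ j) : x' ⊔ j = y' ⊔ j :=
  le_antisymm
    (sup_le (le_sup_of_isCompl hx hy (h ▸ le_sup_left)) le_sup_right)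
    (sup_le (le_sup_of_isCompl hy hx (h.symm ▸ le_sup_left)) le_sup_right)

variable (I) in
/-- The congruence that identifies `x` and `y` when each `φ i x` and `φ i y` agree modulo the
ideal `J`. -/
def idealCon (J : Order.Ideal A) : LMCon I A where
  r x y := ∀ i : I, ∃ j ∈ J, phi i x ⊔ j = phi i y ⊔ j
  iseqv :=
    { refl := fun _ _ => ⟨⊥, J.bot_mem, rfl⟩
      symm := fun h i => (h i).imp fun _ hj => ⟨hj.1, hj.2.symm⟩
      trans := by
        intro x y z hxy hyz i
        obtain ⟨j, hj, hj'⟩ := hxy i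
        obtain ⟨k, hk, hk'⟩ := hyz i
        refine ⟨j ⊔ k, Order.Ideal.sup_mem hj hk, ?_⟩
        rw [← sup_assoc, hj', sup_right_comm, hk', sup_right_comm, sup_assoc] }
  inf := by
    intro w x y z hwx hyz i
    obtain ⟨j, hj, hj'⟩ := hwx i
    obtain ⟨k, hk, hk'⟩ := hyz i
    refine ⟨j ⊔ k, Order.Ideal.sup_mem hj hk, ?_⟩
    rw [map_inf, map_inf, sup_inf_right, sup_inf_right, ← sup_assoc, hj', sup_assoc,
      sup_left_comm (phi i y), hk', sup_left_comm j]
  sup := by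
    intro w x y z hwx hyz i
    obtain ⟨j, hj, hj'⟩ := hwx i
    obtain ⟨k, hk, hk'⟩ := hyz i
    refine ⟨j ⊔ k, Order.Ideal.sup_mem hj hk, ?_⟩
    rw [map_sup, map_sup, sup_sup_sup_comm, hj', hk', sup_sup_sup_comm]
  map_phi := by
    intro k x y h i
    obtain ⟨j, hj, hj'⟩ := h k
    exact ⟨j, hj, by rwa [phi_phi, phi_phi]⟩
  map_phibar := by
    intro k x y h i
    obtain ⟨j, hj, hj'⟩ := h k
    refine ⟨j, hj, ?_⟩
    rw [phi_phibar, phi_phibar]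
    exact sup_eq_sup_of_isCompl (isCompl_phi_phibar k x) (isCompl_phi_phibar k y) hj'

/-- The ideal of the elements congruent to `⊥`. -/
def LMCon.kernel (c : LMCon I A) : Order.Ideal A where
  carrier := {x | c.r x ⊥}
  lower' := by
    intro x y hyx hx
    have h := c.inf hx (c.iseqv.refl y)
    rwa [inf_eq_right.2 hyx, bot_inf_eq] at h
  nonempty' := ⟨⊥, c.iseqv.refl ⊥⟩
  directed' := by
    intro x hx y hy
    refine ⟨x ⊔ y, ?_, le_sup_left, le_sup_right⟩
    have h := c.sup hx hy
    rwa [bot_sup_eq] at h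

/-- Modulo `c` the element equals `phi i x ⊓ phibar i x = ⊥`. -/
theorem LMCon.phi_inf_phibar_mem_kernel {c : LMCon I A} {x y : A} (h : c.r x y) (i : I) :
    phi i y ⊓ phibar i x ∈ c.kernel := by
  have h' := c.inf (c.map_phi i (c.iseqv.symm h)) (c.iseqv.refl (phibar i x))
  rwa [(isCompl_phi_phibar i x).inf_eq_bot] at h'

theorem phi_sup_phi_inf_phibar (i : I) (x y : A) :
    phi i x ⊔ phi i y ⊓ phibar i x = phi i x ⊔ phi i y := by
  rw [sup_inf_left, (isCompl_phi_phibar i x).sup_eq_top, inf_top_eq]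

theorem LMCon.le_idealCon {c : LMCon I A} {J : Order.Ideal A} (h : c.kernel ≤ J) :
    c ≤ idealCon I J := by
  intro x y hxy i
  -- The witness is the symmetric difference of `phi i x` and `phi i y`; joining it to either one
  -- gives `phi i x ⊔ phi i y`.
  refine ⟨phi i y ⊓ phibar i x ⊔ phi i x ⊓ phibar i y,
    Order.Ideal.sup_mem (h (phi_inf_phibar_mem_kernel hxy i))
      (h (phi_inf_phibar_mem_kernel (c.iseqv.symm hxy) i)), ?_⟩
  have hx : phi i x ⊓ phibar i y ≤ phi i x := inf_le_left
  have hy : phi i y ⊓ phibar i x ≤ phi i y := inf_le_left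
  rw [← sup_assoc, phi_sup_phi_inf_phibar, sup_eq_left.2 (hx.trans le_sup_left),
    sup_left_comm, phi_sup_phi_inf_phibar, sup_comm (phi i y) (phi i x),
    sup_eq_right.2 (hy.trans le_sup_right)]

theorem principalCon_r (a b : A) : (principalCon I a b).r a b :=
  fun _ hc => hc

theorem principalCon_le {a b : A} {c : LMCon I A} (h : c.r a b) : principalCon I a b ≤ c :=
  fun _ _ hxy => hxy c h

theorem idealCon_r_of_le {a b : A} (hab : a ≤ b) {J : Order.Ideal A}
    (hJ : ∀ i : I, phi i b ⊓ phibar i a ∈ J) : (idealCon I J).r a b := by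
  intro i
  refine ⟨_, hJ i, ?_⟩
  have hle : phi i b ⊓ phibar i a ≤ phi i b := inf_le_left
  rw [phi_sup_phi_inf_phibar, sup_eq_left.2 hle, sup_eq_right.2]
  exact OrderHomClass.mono (phi i) hab

theorem idealCon_principal_r {e x y : A} :
    (idealCon I (Order.Ideal.principal e)).r x y ↔ ∀ i : I, phi i x ⊔ e = phi i y ⊔ e := by
  refine forall_congr' fun i => ⟨?_, fun h => ⟨e, Order.Ideal.mem_principal_self, h⟩⟩
  rintro ⟨j, hj, h⟩
  have hj' : j ⊔ e = e := sup_eq_right.2 (Order.Ideal.mem_principal.1 hj)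
  rw [← hj', ← sup_assoc, h, sup_assoc]

theorem LMCon.eq_top_of_r_bot_top {c : LMCon I A} (h : c.r ⊥ ⊤) : c = ⊤ := by
  have hx (x : A) : c.r ⊥ x := by
    have := c.inf h (c.iseqv.refl x)
    rwa [bot_inf_eq, top_inf_eq] at this
  exact top_unique fun x y _ => c.iseqv.trans (c.iseqv.symm (hx x)) (hx y)

theorem LMCon.bot_r {x y : A} : (⊥ : LMCon I A).r x y ↔ x = y := by
  refine ⟨fun h => ?_, fun h => h ▸ (⊥ : LMCon I A).iseqv.refl x⟩
  let c : LMCon I A :=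
    { r := Eq
      iseqv := eq_equivalence
      inf := fun h₁ h₂ => by rw [h₁, h₂]
      sup := fun h₁ h₂ => by rw [h₁, h₂]
      map_phi := fun _ _ _ h => by rw [h]
      map_phibar := fun _ _ _ h => by rw [h] }
  exact (bot_le : ⊥ ≤ c) x y h

theorem isBooleanCon_principalCon_of_isComplemented [Nonempty I] {a b e : A} (hab : a ≤ b)
    (hle : ∀ i : I, phi i b ⊓ phibar i a ≤ e)
    (he : e ∈ (principalCon I a b).kernel) (hphi : ∀ i : I, phi i e = e)
    (hcompl : IsComplemented e) : IsBooleanCon (principalCon I a b) := by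
  obtain ⟨e', he'⟩ := hcompl
  refine ⟨idealCon I (Order.Ideal.principal e'), disjoint_iff.2 ?_, codisjoint_iff.2 ?_⟩
  -- Each `phi i x` and `phi i y` agree modulo `e` and modulo `e'`, hence are equal because `e ⊓ e'
  -- = ⊥`; determination then gives `x = y`.
  · refine le_bot_iff.1 fun x y hxy => LMCon.bot_r.2 ?_
    refine LMAlgebra.determination (I := I) x y fun i => ?_
    have h₁ := idealCon_principal_r.1 (principalCon_le
      (idealCon_r_of_le hab fun i => Order.Ideal.mem_principal.2 (hle i)) x y
      ((inf_le_left : principalCon I a b ⊓ _ ≤ _) x y hxy)) i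
    have h₂ := idealCon_principal_r.1
      ((inf_le_right : principalCon I a b ⊓ _ ≤ _) x y hxy) i
    calc phi i x = (phi i x ⊔ e) ⊓ (phi i x ⊔ e') := by
          rw [← sup_inf_left, he'.inf_eq_bot, sup_bot_eq]
      _ = phi i y := by rw [h₁, h₂, ← sup_inf_left, he'.inf_eq_bot, sup_bot_eq]
  -- The join identifies `⊥` with both `e` and `e'`, hence with `e ⊔ e' = ⊤`.
  · set d := idealCon I (Order.Ideal.principal e') with hd
    have h' : d.r ⊥ e' := by
      refine idealCon_principal_r.2 fun i => ?_
      rw [map_bot, phi_eq_of_isCompl he' (hphi i), bot_sup_eq, sup_idem]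
    have h₁ : (principalCon I a b ⊔ d).r ⊥ e :=
      (le_sup_left : _ ≤ principalCon I a b ⊔ d) _ _
        ((principalCon I a b).iseqv.symm he)
    have h₂ := (le_sup_right : d ≤ principalCon I a b ⊔ d) _ _ h'
    apply LMCon.eq_top_of_r_bot_top
    have := (principalCon I a b ⊔ d).sup h₁ h₂
    rwa [bot_sup_eq, he'.sup_eq_top] at this

theorem LMCon.eq_bot_of_mem_kernel_of_disjoint {c d : LMCon I A} (h : Disjoint c d) {x : A}
    (hc : x ∈ c.kernel) (hd : x ∈ d.kernel) : x = ⊥ := by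
  refine LMCon.bot_r.1 (h.le_bot x ⊥ ?_)
  have hle : sInf {c, d} ≤ c ⊓ d := le_inf (sInf_le (by simp)) (sInf_le (by simp))
  refine hle x ⊥ ?_
  rintro e (rfl | rfl)
  · exact hc
  · exact hd

/-- Bounding `c ⊔ d` by the congruence of the ideal `c.kernel ⊔ d.kernel` avoids describing joins of
congruences: as `c ⊔ d = ⊤`, that ideal contains `⊤`. -/
theorem LMCon.exists_isCompl_of_isCompl [Nonempty I] {c d : LMCon I A} (h : IsCompl c d) :
    ∃ s t : A, IsCompl s t ∧ s ∈ c.kernel ∧ t ∈ d.kernel ∧ ∀ i : I, phi i s = s := by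
  have hle : c ⊔ d ≤ idealCon I (c.kernel ⊔ d.kernel) :=
    sup_le (le_idealCon le_sup_left) (le_idealCon le_sup_right)
  have htop : (c ⊔ d).r ⊥ ⊤ := by
    rw [h.sup_eq_top]
    exact (le_top : idealCon I (⊤ : Order.Ideal A) ≤ ⊤) _ _ fun i =>
      ⟨⊤, Set.mem_univ _, by simp⟩
  obtain ⟨i⟩ := ‹Nonempty I›
  obtain ⟨j, ⟨s, hs, t, ht, hj⟩, hj'⟩ := hle _ _ htop i
  rw [map_bot, map_top, bot_sup_eq, top_sup_eq] at hj'
  have hst : s ⊔ t = ⊤ := top_unique (hj' ▸ hj)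
  have hs' : phi i s ∈ c.kernel := by
    have := c.map_phi i hs
    rwa [map_bot] at this
  have ht' : phi i t ∈ d.kernel := by
    have := d.map_phi i ht
    rwa [map_bot] at this
  -- Applying `phi i` keeps the join `⊤` and both kernel memberships, and makes the first element
  -- invariant under all `phi k`.
  refine ⟨phi i s, phi i t, IsCompl.of_eq ?_ ?_, hs', ht', fun k => phi_phi k i s⟩
  · exact eq_bot_of_mem_kernel_of_disjoint h.disjoint (c.kernel.lower inf_le_left hs')
      (d.kernel.lower inf_le_right ht')
  · rw [← map_sup, hst, map_top]

end Congruences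

/-! ### The prime spectrum and its compactness. -/

section Spectrum

variable {A : Type v} [DistribLattice A] [BoundedOrder A]

theorem sigma_inf (a b : A) : sigma (a ⊓ b) = sigma a ∩ sigma b := by
  ext P
  exact Order.PFilter.inf_mem_iff

theorem sigma_mono {a b : A} (h : a ≤ b) : sigma a ⊆ sigma b :=
  fun P hP => Order.PFilter.mem_of_le (F := P.1) h hP

theorem sigma_top : sigma (⊤ : A) = Set.univ :=
  Set.eq_univ_of_forall fun _ => Order.PFilter.top_mem

theorem sigma_bot : sigma (⊥ : A) = ∅ :=
  Set.eq_empty_of_forall_notMem fun P hP => P.2.compl_ideal.toIdeal.bot_mem hP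

theorem sigma_sup (a b : A) : sigma (a ⊔ b) = sigma a ∪ sigma b := by
  refine Set.Subset.antisymm (fun P hP => ?_)
    (Set.union_subset (sigma_mono le_sup_left) (sigma_mono le_sup_right))
  by_contra h
  rw [Set.mem_union, not_or] at h
  exact Order.Ideal.sup_mem (s := P.2.compl_ideal.toIdeal) h.1 h.2 hP

theorem sigma_compl_of_isCompl {a b : A} (h : IsCompl a b) : (sigma a)ᶜ = sigma b := by
  refine (IsCompl.of_eq ?_ ?_ : IsCompl (sigma a) (sigma b)).compl_eq
  · exact (sigma_inf a b).symm.trans (h.inf_eq_bot ▸ sigma_bot)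
  · exact (sigma_sup a b).symm.trans (h.sup_eq_top ▸ sigma_top)

theorem sigma_subset_sigma {a b : A} : sigma a ⊆ sigma b ↔ a ≤ b := by
  refine ⟨fun h => ?_, sigma_mono⟩
  -- The prime ideal theorem separates the filter above `a` from the ideal below `b`; the complement
  -- of the prime ideal is a prime filter containing `a` but not `b`.
  by_contra hab
  obtain ⟨J, hJ, hbJ, hJa⟩ := DistribLattice.prime_ideal_of_disjoint_filter_ideal
    (F := Order.PFilter.principal a) (I := Order.Ideal.principal b) <| by
      rw [Set.disjoint_left]
      intro x hx hx'
      exact hab ((Order.PFilter.mem_principal.1 hx).trans (Order.Ideal.mem_principal.1 hx'))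
  let P : PrimeFilter A := ⟨hJ.toPrimePair.F, hJ.toPrimePair.F_isPrime⟩
  have haP : P ∈ sigma a := fun ha =>
    Set.disjoint_left.1 hJa (Order.PFilter.mem_principal.2 le_rfl) ha
  exact h haP (hbJ Order.Ideal.mem_principal_self)

theorem isOpen_sigma (a : A) : IsOpen (sigma a) :=
  TopologicalSpace.isOpen_generateFrom_of_mem ⟨a, Or.inl rfl⟩

theorem isClosed_sigma (a : A) : IsClosed (sigma a) :=
  ⟨TopologicalSpace.isOpen_generateFrom_of_mem ⟨a, Or.inr rfl⟩⟩

/-- The prime filter to which an ultrafilter on the spectrum converges. -/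
def ultrafilterLim (U : Ultrafilter (PrimeFilter A)) : PrimeFilter A where
  val := Order.IsPFilter.toPFilter (F := {a : A | sigma a ∈ U}) <| by
    refine Order.IsPFilter.of_def ⟨⊤, ?_⟩ ?_ ?_
    · rw [Set.mem_ofPred_eq, sigma_top]
      exact Filter.univ_mem
    · intro x hx y hy
      refine ⟨x ⊓ y, ?_, inf_le_left, inf_le_right⟩
      rw [Set.mem_ofPred_eq, sigma_inf]
      exact Filter.inter_mem hx hy
    · intro x y hxy hx
      exact Filter.mem_of_superset hx (sigma_mono hxy)
  property := by
    refine ⟨⟨?_, ⟨⊥, ?_⟩, ?_⟩⟩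
    · intro x y hyx hx hy
      exact hx (Filter.mem_of_superset hy (sigma_mono hyx))
    · intro h
      have h' : sigma (⊥ : A) ∈ U := h
      rw [sigma_bot] at h'
      exact U.empty_notMem h'
    · intro x hx y hy
      refine ⟨x ⊔ y, fun h => ?_, le_sup_left, le_sup_right⟩
      have h' : sigma (x ⊔ y) ∈ U := h
      rw [sigma_sup, Ultrafilter.union_mem_iff] at h'
      exact h'.elim hx hy

/-- It suffices to test subbasic sets: `U` contains `sigma a` or its complement according to whether
`a` lies in the limit. -/
theorem ultrafilter_le_nhds_ultrafilterLim (U : Ultrafilter (PrimeFilter A)) :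
    (U : Filter (PrimeFilter A)) ≤ nhds (ultrafilterLim U) := by
  rw [TopologicalSpace.nhds_generateFrom]
  refine le_iInf₂ fun s hs => Filter.le_principal_iff.2 ?_
  obtain ⟨hP, a, rfl | rfl⟩ := hs
  · exact hP
  · exact Ultrafilter.compl_mem_iff_notMem.2 hP

instance : CompactSpace (PrimeFilter A) :=
  ⟨isCompact_iff_ultrafilter_le_nhds.2 fun U _ =>
    ⟨ultrafilterLim U, Set.mem_univ _, ultrafilter_le_nhds_ultrafilterLim U⟩⟩

/-- The ideal of the elements whose basic open set lies in `W`. -/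
def sigmaIdeal (W : Set (PrimeFilter A)) : Order.Ideal A where
  carrier := {x | sigma x ⊆ W}
  lower' := fun _ _ hyx hx => (sigma_mono hyx).trans hx
  nonempty' := ⟨⊥, by rw [Set.mem_ofPred_eq, sigma_bot]; exact Set.empty_subset W⟩
  directed' := by
    intro x hx y hy
    refine ⟨x ⊔ y, ?_, le_sup_left, le_sup_right⟩
    rw [Set.mem_ofPred_eq, sigma_sup]
    exact Set.union_subset hx hy

theorem mem_sigmaIdeal {W : Set (PrimeFilter A)} {x : A} : x ∈ sigmaIdeal W ↔ sigma x ⊆ W :=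
  Iff.rfl

theorem sigma_finset_sup {ι : Type*} (s : Finset ι) (f : ι → A) :
    sigma (s.sup f) = ⋃ i ∈ s, sigma (f i) := by
  classical
  induction s using Finset.induction_on with
  | empty => simp [sigma_bot]
  | insert i s _ ih => rw [Finset.sup_insert, sigma_sup, ih, Finset.set_biUnion_insert]

/-! ### Boolean principal congruences and closed sets. -/

variable {I : Type u} [LinearOrder I] [LMAlgebra I A]

theorem spaceMap_preimage_sigma (i : I) (a : A) : spaceMap i ⁻¹' sigma a = sigma (phi i a) :=
  rfl

theorem spaceMap_preimage_sigma_diff (i : I) (a b : A) :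
    spaceMap i ⁻¹' (sigma b \ sigma a) = sigma (phi i b ⊓ phibar i a) := by
  rw [Set.preimage_sdiff, spaceMap_preimage_sigma, spaceMap_preimage_sigma, sigma_inf,
    ← sigma_compl_of_isCompl (isCompl_phi_phibar i a), Set.sdiff_eq]

theorem isBooleanCon_of_isClosed [Nonempty I] {a b : A} (hab : a ≤ b)
    (h : IsClosed (⋃ i : I, sigma (phi i b ⊓ phibar i a))) :
    IsBooleanCon (principalCon I a b) := by
  -- The closed union is compact and is covered by its own open members.
  obtain ⟨s, hs⟩ := h.isCompact.elim_finite_subcover _ (fun i => isOpen_sigma _) subset_rfl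
  rw [← sigma_finset_sup] at hs
  refine isBooleanCon_principalCon_of_isComplemented hab
    (e := s.sup fun i => phi i b ⊓ phibar i a) (fun i => ?_) ?_ (fun i => ?_) ?_
  · exact sigma_subset_sigma.1 ((Set.subset_iUnion _ i).trans hs)
  · exact (Order.Ideal.finsetSup_mem_iff _).2 fun i _ =>
      LMCon.phi_inf_phibar_mem_kernel (principalCon_r a b) i
  · rw [map_finset_sup]
    refine Finset.sup_congr rfl fun j _ => ?_
    rw [Function.comp_apply, map_inf, phi_phi, phi_phibar]
  · refine Finset.sup_induction isComplemented_bot (fun _ h₁ _ h₂ => h₁.sup h₂) fun i _ => ?_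
    exact IsComplemented.inf ⟨_, isCompl_phi_phibar i b⟩ ⟨_, (isCompl_phi_phibar i a).symm⟩

theorem isClosed_of_isBooleanCon [Nonempty I] {a b : A} (hab : a ≤ b)
    (h : IsBooleanCon (principalCon I a b)) :
    IsClosed (⋃ i : I, sigma (phi i b ⊓ phibar i a)) := by
  obtain ⟨d, hd⟩ := h
  obtain ⟨s, t, hst, hs, ht, hphi⟩ := LMCon.exists_isCompl_of_isCompl hd
  suffices (⋃ i : I, sigma (phi i b ⊓ phibar i a)) = sigma s from this ▸ isClosed_sigma s
  refine Set.Subset.antisymm (Set.iUnion_subset fun i => sigma_mono ?_) ?_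
  · have hmem := LMCon.phi_inf_phibar_mem_kernel (principalCon_r (I := I) a b) i
    have hbot : (phi i b ⊓ phibar i a) ⊓ t = ⊥ :=
      LMCon.eq_bot_of_mem_kernel_of_disjoint hd.disjoint
        ((principalCon I a b).kernel.lower inf_le_left hmem) (d.kernel.lower inf_le_right ht)
    -- An element disjoint from `t` lies below its complement `s`.
    exact hst.symm.disjoint_left_iff.1 (disjoint_iff.2 hbot)
  · set W := ⋃ i : I, sigma (phi i b ⊓ phibar i a)
    -- Minimality of `Θ(a, b)` carries the pair `(s, ⊥)` into this congruence, so `s` lies below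
    -- some `j` with `sigma j ⊆ W`.
    have hle : principalCon I a b ≤ idealCon I (sigmaIdeal W) :=
      principalCon_le (idealCon_r_of_le hab fun i => mem_sigmaIdeal.2
        (Set.subset_iUnion (fun i : I => sigma (phi i b ⊓ phibar i a)) i))
    obtain ⟨i⟩ := ‹Nonempty I›
    obtain ⟨j, hj, hj'⟩ := hle _ _ hs i
    rw [map_bot, bot_sup_eq, hphi] at hj'
    exact (sigma_mono (sup_eq_right.1 hj')).trans hj

end Spectrum

end LM

theorem mainTheorem4 {I : Type*} {A : Type*} [LinearOrder I] [Nonempty I]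
    [DistribLattice A] [BoundedOrder A] [LM.LMAlgebra I A] (a b : A) (hab : a ≤ b) :
    List.TFAE
      [LM.IsBooleanCon (LM.principalCon I a b),
        IsClosed (⋃ i : I, LM.spaceMap i ⁻¹' (LM.sigma b \ LM.sigma a)),
        IsClosed (⋃ i : I, LM.sigma (LM.phi i b ⊓ LM.phibar i a))] := by
  simp_rw [LM.spaceMap_preimage_sigma_diff]
  tfae_have 1 → 3 := LM.isClosed_of_isBooleanCon hab
  tfae_have 3 → 1 := LM.isBooleanCon_of_isClosed hab
  tfae_have 2 ↔ 3 := Iff.rfl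
  tfae_finish
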